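/- Let $m,n\ge 0$ be integers and let $A$ be any real $m\times n$ matrix. Let $X=(X_1,\dots,X_n)^t$ be a random vector with independent real components such that each $X_i$ has zero mean, has a probability density that is continuous and positive inside its support interval (an open, possibly unbounded interval outside which the density vanishes), and has finite differential entropy $h(X_i)$. Let $X^*=(X_1^*,\dots,X_n^*)^t$ be a normal random vector with independent components such that $$h(X_i^*)=h(X_i)\qquad (i=1,\dots,n).$$ Then $$h(AX)\ \ge\ h(AX^*).$$ Here, for a random vector $Y$ in $\mathbb{R}^k$ with density $f$ with respect to Lebesgue measure, $h(Y)=-\int_{\mathbb{R}^k} f\log f\,dx\in[-\infty,+\infty]$ (the integral of the positive part of $-f\log f$ minus the integral of its negative part), and $h(Y)=-\infty$ if $Y$ has no density (for instance $AX$ and $AX^*$ when $A$ has rank less than $m$). -/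

import Mathlib

open MeasureTheory ProbabilityTheory Set
open scoped ENNReal NNReal Matrix

/-- Differential entropy (in nats) of a measure `ν` on a space with a reference volume
(here `ℝ` or `Fin m → ℝ` with Lebesgue measure), as an extended real number. If `ν` has a density
`f`, it is `∫ -f log f`, that is, the integral of the positive part of `-f log f` minus the integral
of its negative part; if `ν` has no density, it is `-∞`. In `EReal` one has `⊤ - ⊤ = ⊥`, so the value
is different from `⊥` only if the integral `∫ -f log f` makes sense. -/
noncomputable def entropyOfLaw {E : Type*} [MeasureSpace E] (ν : Measure E) : EReal :=
  open Classical in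
  if ν ≪ (volume : Measure E) then
    ((∫⁻ x, ENNReal.ofReal (Real.negMulLog (ν.rnDeriv volume x).toReal) : ℝ≥0∞) : EReal)
      - ((∫⁻ x, ENNReal.ofReal (-Real.negMulLog (ν.rnDeriv volume x).toReal) : ℝ≥0∞) : EReal)
  else ⊥

/-- Differential entropy `h(Y)` of a random variable or random vector `Y`: that of its law. -/
noncomputable def diffEntropy {Ω E : Type*} [MeasurableSpace Ω] [MeasureSpace E]
    (Y : Ω → E) (P : Measure Ω) : EReal :=
  entropyOfLaw (P.map Y)

/-- The real random variable `Y` has a density `f` that is continuous and positive inside its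
support interval: `f` is continuous and positive on an open interval `I` (possibly unbounded) and
vanishes outside `I`. -/
def HasDensityOnInterval {Ω : Type*} [MeasurableSpace Ω] (Y : Ω → ℝ) (P : Measure Ω) : Prop :=
  ∃ (I : Set ℝ) (f : ℝ → ℝ), IsOpen I ∧ I.OrdConnected ∧ ContinuousOn f I ∧
    (∀ x ∈ I, 0 < f x) ∧ (∀ x ∉ I, f x = 0) ∧
    P.map Y = volume.withDensity (fun x => ENNReal.ofReal (f x))

/-!
The proof is by transport of measure. If `A` is not surjective, `A X*` has no density and nothing is
to be shown. Otherwise let `T i` be the increasing map of the line carrying the law of `X* i` to the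
law of `X i` (`IsIntervalDensity.exists_transport`); the hypotheses on the density of `X i` make `T i`
differentiable with positive derivative, and `h(X i) = h(X* i) + E log T i'(X* i)`, so equality of the
entropies says that `log T i'(X* i)` has mean zero. Standardising `X* i = σ i * G i + μ i` and
factoring `A * diag σ = B * Q` with `B` invertible and `Q` with orthonormal rows
(`exists_eq_mul_orthonormal_rows`), one has `A X = B Q t(G)` and `A X* = B Q G + const` in law, where
`t i` is `T i` in standardised coordinates (`exists_standardised_transport`).

Conditionally on the component of `G` orthogonal to the rows of `Q`, the vector `B Q t(G)` is an
injective function of `Q G`, with Jacobian determinant `det B * det (Q D Qᵀ)`, `D = diag (t i'(G i))`.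
By concavity of the logarithm, `log det (Q D Qᵀ) ≥ ∑ i, c i * log t i'(G i)` with nonnegative constants
`c i` (`sum_mul_log_le_log_det`), and the right-hand side has mean zero. As conditioning does not
increase entropy, `h(A X)` is at least the entropy of `B Q G + const`.

Conditional entropies are not needed as such. Let `f` be the density of `W = B Q t(G)` and `k` its
conditional density. The bound `E [f(W) / k(W)] ≤ 1` is one change of variables in `ℝⁿ`, by the map
applying `t` along the row space of `Q` only (`lintegral_density_div_conditional_le`). With
`log r ≤ r - 1` it gives a pointwise lower bound for `-log f(W)` by an integrable function of the
right mean (`gaussianImageEntropy_le_entropyOfLaw`). An integrable lower bound of this kind also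
shows that the negative part of the entropy integral is finite, so that `h(A X)` is not the
undefined difference `⊤ - ⊤`. The matching upper bound for `A X*` is Gibbs' inequality
(`entropyOfLaw_affine_gaussian_le`).
-/

/-! ### Entropy as an expected information density -/

/-- The information density `-log f` of a measure with Lebesgue density `f`. The density is the
Radon–Nikodym derivative, so this is meaningful only for absolutely continuous measures. -/
noncomputable def infoDensity {E : Type*} [MeasureSpace E] (ν : Measure E) (x : E) : ℝ :=
  -Real.log (ν.rnDeriv volume x).toReal

lemma measurable_infoDensity {E : Type*} [MeasureSpace E] (ν : Measure E) :
    Measurable (infoDensity ν) := by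
  unfold infoDensity
  exact (Real.measurable_log.comp (Measure.measurable_rnDeriv _ _).ennreal_toReal).neg

lemma lintegral_ofReal_toReal_rnDeriv_mul {E : Type*} [MeasureSpace E]
    [SigmaFinite (volume : Measure E)] {ν : Measure E} [IsFiniteMeasure ν]
    (hν : ν ≪ volume) {g : E → ℝ} (hg : Measurable g) :
    ∫⁻ x, ENNReal.ofReal ((ν.rnDeriv volume x).toReal * g x) = ∫⁻ x, ENNReal.ofReal (g x) ∂ν := by
  rw [← lintegral_rnDeriv_mul hν hg.ennreal_ofReal.aemeasurable]
  refine lintegral_congr_ae ?_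
  filter_upwards [Measure.rnDeriv_lt_top ν volume] with x hx
  rw [ENNReal.ofReal_mul ENNReal.toReal_nonneg, ENNReal.ofReal_toReal hx.ne]

lemma entropyOfLaw_eq {E : Type*} [MeasureSpace E]
    [SigmaFinite (volume : Measure E)] {ν : Measure E} [IsFiniteMeasure ν]
    (hν : ν ≪ volume) :
    entropyOfLaw ν = ((∫⁻ x, ENNReal.ofReal (infoDensity ν x) ∂ν : ℝ≥0∞) : EReal)
      - ((∫⁻ x, ENNReal.ofReal (-infoDensity ν x) ∂ν : ℝ≥0∞) : EReal) := by
  have hm := measurable_infoDensity ν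
  rw [entropyOfLaw, if_pos hν, ← lintegral_ofReal_toReal_rnDeriv_mul hν hm,
    ← lintegral_ofReal_toReal_rnDeriv_mul (g := fun x => -infoDensity ν x) hν hm.neg]
  simp [infoDensity, Real.negMulLog]

lemma coe_integral_eq_sub {α : Type*} [MeasurableSpace α] {μ : Measure α} {R : α → ℝ}
    (hR : Integrable R μ) :
    ((∫ a, R a ∂μ : ℝ) : EReal) = ((∫⁻ a, ENNReal.ofReal (R a) ∂μ : ℝ≥0∞) : EReal)
      - ((∫⁻ a, ENNReal.ofReal (-R a) ∂μ : ℝ≥0∞) : EReal) := by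
  have hneg : ∫⁻ a, ENNReal.ofReal (-R a) ∂μ ≠ ⊤ := hR.neg.lintegral_lt_top.ne
  rw [integral_eq_lintegral_pos_part_sub_lintegral_neg_part hR, EReal.coe_sub,
    EReal.coe_ennreal_toReal hR.lintegral_lt_top.ne, EReal.coe_ennreal_toReal hneg]

/-- An integrable lower bound for the information density bounds the entropy from below. In
particular the negative part of the entropy integral is then finite. -/
lemma integral_le_entropyOfLaw_map {α E : Type*} [MeasurableSpace α] [MeasureSpace E]
    [SigmaFinite (volume : Measure E)] {μ : Measure α} [IsFiniteMeasure μ] {W : α → E}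
    (hW : AEMeasurable W μ) (hac : μ.map W ≪ volume) {R : α → ℝ} (hR : Integrable R μ)
    (hle : ∀ᵐ a ∂μ, R a ≤ infoDensity (μ.map W) (W a)) :
    ((∫ a, R a ∂μ : ℝ) : EReal) ≤ entropyOfLaw (μ.map W) := by
  have hm := measurable_infoDensity (μ.map W)
  rw [entropyOfLaw_eq hac, coe_integral_eq_sub hR,
    lintegral_map' hm.ennreal_ofReal.aemeasurable hW,
    lintegral_map' (f := fun x => ENNReal.ofReal (-infoDensity (μ.map W) x))
      hm.neg.ennreal_ofReal.aemeasurable hW]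
  refine EReal.sub_le_sub ?_ ?_ <;> rw [EReal.coe_ennreal_le_coe_ennreal_iff] <;>
    refine lintegral_mono_ae ?_ <;> filter_upwards [hle] with a ha
  · exact ENNReal.ofReal_le_ofReal ha
  · exact ENNReal.ofReal_le_ofReal (neg_le_neg ha)

lemma entropyOfLaw_map_le_integral {α E : Type*} [MeasurableSpace α] [MeasureSpace E]
    [SigmaFinite (volume : Measure E)] {μ : Measure α} [IsFiniteMeasure μ] {W : α → E}
    (hW : AEMeasurable W μ) (hac : μ.map W ≪ volume) {R : α → ℝ} (hR : Integrable R μ)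
    (hle : ∀ᵐ a ∂μ, infoDensity (μ.map W) (W a) ≤ R a) :
    entropyOfLaw (μ.map W) ≤ ((∫ a, R a ∂μ : ℝ) : EReal) := by
  have hm := measurable_infoDensity (μ.map W)
  rw [entropyOfLaw_eq hac, coe_integral_eq_sub hR,
    lintegral_map' hm.ennreal_ofReal.aemeasurable hW,
    lintegral_map' (f := fun x => ENNReal.ofReal (-infoDensity (μ.map W) x))
      hm.neg.ennreal_ofReal.aemeasurable hW]
  refine EReal.sub_le_sub ?_ ?_ <;> rw [EReal.coe_ennreal_le_coe_ennreal_iff] <;>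
    refine lintegral_mono_ae ?_ <;> filter_upwards [hle] with a ha
  · exact ENNReal.ofReal_le_ofReal ha
  · exact ENNReal.ofReal_le_ofReal (neg_le_neg ha)

lemma absolutelyContinuous_of_entropyOfLaw_ne_bot {E : Type*} [MeasureSpace E] {ν : Measure E}
    (h : entropyOfLaw ν ≠ ⊥) : ν ≪ volume := by
  by_contra hac
  exact h (if_neg hac)

lemma integrable_infoDensity_of_entropyOfLaw_finite {E : Type*} [MeasureSpace E]
    [SigmaFinite (volume : Measure E)] {ν : Measure E} [IsFiniteMeasure ν]
    (h : entropyOfLaw ν ≠ ⊥) (h' : entropyOfLaw ν ≠ ⊤) : Integrable (infoDensity ν) ν := by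
  have hac := absolutelyContinuous_of_entropyOfLaw_ne_bot h
  rw [entropyOfLaw_eq hac] at h h'
  have hm := measurable_infoDensity ν
  have hneg : ∫⁻ x, ENNReal.ofReal (-infoDensity ν x) ∂ν ≠ ⊤ := by
    intro h0
    exact h (by rw [h0]; simp)
  have hpos : ∫⁻ x, ENNReal.ofReal (infoDensity ν x) ∂ν ≠ ⊤ := by
    intro h0
    apply h'
    rw [h0, ← ENNReal.ofReal_toReal hneg, EReal.coe_ennreal_top]
    rw [EReal.coe_ennreal_ofReal]
    exact EReal.top_sub_coe _
  have key : ∀ g : E → ℝ, Measurable g → ∫⁻ x, ENNReal.ofReal (g x) ∂ν ≠ ⊤ →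
      Integrable (fun x => max (g x) 0) ν := by
    intro g hg hfin
    refine ⟨(hg.max measurable_const).aestronglyMeasurable, ?_⟩
    refine (hasFiniteIntegral_iff_ofReal (f := fun x => max (g x) 0)
      (Filter.Eventually.of_forall fun x => le_max_right (g x) 0)).2 ?_
    simpa [ENNReal.ofReal_max] using hfin.lt_top
  have h1 := key _ hm hpos
  have h2 := key _ hm.neg hneg
  refine (h1.sub h2).congr (Filter.Eventually.of_forall fun x => ?_)
  simp only [Pi.sub_apply, Pi.neg_apply]
  rcases le_total 0 (infoDensity ν x) with hx | hx
  · rw [max_eq_left hx, max_eq_right (by linarith)]; ring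
  · rw [max_eq_right hx, max_eq_left (by linarith)]; ring

lemma entropyOfLaw_eq_integral {E : Type*} [MeasureSpace E]
    [SigmaFinite (volume : Measure E)] {ν : Measure E} [IsFiniteMeasure ν]
    (hν : ν ≪ volume) (hi : Integrable (infoDensity ν) ν) :
    entropyOfLaw ν = ((∫ x, infoDensity ν x ∂ν : ℝ) : EReal) := by
  rw [entropyOfLaw_eq hν, coe_integral_eq_sub hi]

lemma infoDensity_ae_eq_of_withDensity {E : Type*} [MeasureSpace E]
    [SigmaFinite (volume : Measure E)] {ν : Measure E}
    {f : E → ℝ} (hf : Measurable f) (hf0 : ∀ x, 0 ≤ f x)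
    (h : ν = volume.withDensity fun x => ENNReal.ofReal (f x)) :
    infoDensity ν =ᵐ[ν] fun x => -Real.log (f x) := by
  have hac : ν ≪ volume := h ▸ withDensity_absolutelyContinuous _ _
  have := Measure.rnDeriv_withDensity (volume : Measure E) hf.ennreal_ofReal
  rw [← h] at this
  filter_upwards [hac.ae_le this] with x hx
  rw [infoDensity, hx, ENNReal.toReal_ofReal (hf0 x)]

lemma rnDeriv_map_pos {α E : Type*} [MeasurableSpace α] [MeasureSpace E]
    [SigmaFinite (volume : Measure E)] {μ : Measure α} [IsFiniteMeasure μ] {W : α → E}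
    (hW : AEMeasurable W μ) (hac : μ.map W ≪ volume) :
    ∀ᵐ a ∂μ, 0 < ((μ.map W).rnDeriv volume (W a)).toReal := by
  refine ae_of_ae_map (p := fun x => 0 < ((μ.map W).rnDeriv volume x).toReal) hW ?_
  filter_upwards [Measure.rnDeriv_pos hac, hac.ae_le (Measure.rnDeriv_lt_top (μ.map W) volume)]
    with x h1 h2
  exact ENNReal.toReal_pos h1.ne' h2.ne

/-! ### Matrices with orthonormal rows -/

lemma measurable_mulVec {m n : ℕ} (A : Matrix (Fin m) (Fin n) ℝ) : Measurable A.mulVec :=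
  (A.mulVecLin.continuous_of_finiteDimensional).measurable

open scoped MatrixOrder Matrix.Norms.L2Operator in
/-- A matrix whose columns span the target factors as an invertible square matrix times a matrix
with orthonormal rows. -/
lemma exists_eq_mul_orthonormal_rows {m n : ℕ} (A : Matrix (Fin m) (Fin n) ℝ)
    (hA : Function.Surjective A.mulVec) :
    ∃ (B : Matrix (Fin m) (Fin m) ℝ) (Q : Matrix (Fin m) (Fin n) ℝ),
      A = B * Q ∧ B.det ≠ 0 ∧ Q * Qᵀ = 1 := by
  have hinj : Function.Injective A.vecMul := by
    intro u v huv
    have h0 : ∀ w, (u - v) ⬝ᵥ w = 0 := by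
      intro w
      obtain ⟨x, rfl⟩ := hA w
      rw [Matrix.dotProduct_mulVec, Matrix.sub_vecMul]
      simp only at huv
      rw [huv, sub_self, zero_dotProduct]
    exact sub_eq_zero.1 (dotProduct_eq_zero _ h0)
  have hS : (A * Aᵀ).PosDef := by
    have := Matrix.PosDef.mul_conjTranspose_self A hinj
    rwa [Matrix.conjTranspose_eq_transpose_of_trivial] at this
  obtain ⟨C, hC⟩ := CStarAlgebra.nonneg_iff_eq_star_mul_self.1 hS.posSemidef.nonneg
  have hC' : A * Aᵀ = Cᵀ * C := by
    rw [hC, Matrix.star_eq_conjTranspose, Matrix.conjTranspose_eq_transpose_of_trivial]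
  have hdet : C.det ≠ 0 := by
    intro h0
    have := hS.det_pos
    rw [hC', Matrix.det_mul, h0] at this
    simp at this
  have hdet' : Cᵀ.det ≠ 0 := by rwa [Matrix.det_transpose]
  refine ⟨Cᵀ, Cᵀ⁻¹ * A, ?_, hdet', ?_⟩
  · rw [Matrix.mul_nonsing_inv_cancel_left _ _ hdet'.isUnit]
  · rw [Matrix.transpose_mul, Matrix.mul_assoc, ← Matrix.mul_assoc A, hC', Matrix.mul_assoc,
      Matrix.nonsing_inv_mul_cancel_left _ _ hdet'.isUnit, Matrix.transpose_nonsing_inv,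
      Matrix.transpose_transpose, Matrix.mul_nonsing_inv _ hdet.isUnit]

lemma sum_sq_row_eq_one {ι κ : Type*} [Fintype ι] [Fintype κ] [DecidableEq ι]
    {Q : Matrix ι κ ℝ} (hQ : Q * Qᵀ = 1) (a : ι) : ∑ i, Q a i ^ 2 = 1 := by
  have := congrFun (congrFun hQ a) a
  simpa [Matrix.mul_apply, sq] using this

/-- Weighted Jensen inequality for the determinant: if `Q` has orthonormal rows then
`log det (Q D Qᵀ) ≥ tr (Q (log D) Qᵀ)` for a positive diagonal matrix `D`. Diagonalising `Q D Qᵀ`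
replaces `Q` by `UQ` with `U` orthogonal, which changes neither side, and then the eigenvalues are
convex combinations of the diagonal entries. -/
lemma sum_mul_log_le_log_det {ι κ : Type*} [Fintype ι] [Fintype κ] [DecidableEq ι] [DecidableEq κ]
    {Q : Matrix ι κ ℝ} (hQ : Q * Qᵀ = 1) {d : κ → ℝ} (hd : ∀ i, 0 < d i) :
    0 < (Q * Matrix.diagonal d * Qᵀ).det ∧
      ∑ i, (∑ a, Q a i ^ 2) * Real.log (d i) ≤ Real.log (Q * Matrix.diagonal d * Qᵀ).det := by
  set S := Q * Matrix.diagonal d * Qᵀ with hSdef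
  have hS : S.IsHermitian := by
    rw [Matrix.IsHermitian, Matrix.conjTranspose_eq_transpose_of_trivial, hSdef]
    simp [Matrix.transpose_mul, Matrix.mul_assoc]
  set U : Matrix ι ι ℝ := (hS.eigenvectorUnitary : Matrix ι ι ℝ) with hU
  have hUU : Uᵀ * U = 1 := by
    have := Unitary.coe_star_mul_self hS.eigenvectorUnitary
    rwa [Matrix.star_eq_conjTranspose, Matrix.conjTranspose_eq_transpose_of_trivial] at this
  have hUU' : U * Uᵀ = 1 := mul_eq_one_comm.1 hUU
  have hspec : Uᵀ * S * U = Matrix.diagonal hS.eigenvalues := by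
    have h := hS.spectral_theorem
    rw [Unitary.conjStarAlgAut_apply] at h
    rw [← hU, Matrix.star_eq_conjTranspose,
      Matrix.conjTranspose_eq_transpose_of_trivial] at h
    calc Uᵀ * S * U = Uᵀ * (U * Matrix.diagonal (RCLike.ofReal ∘ hS.eigenvalues) * Uᵀ) * U := by
          rw [← h]
      _ = (Uᵀ * U) * Matrix.diagonal (RCLike.ofReal ∘ hS.eigenvalues) * (Uᵀ * U) := by
          simp only [Matrix.mul_assoc]
      _ = _ := by rw [hUU]; simp
  set R : Matrix ι κ ℝ := Uᵀ * Q with hR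
  have hRR : R * Rᵀ = 1 := by
    rw [hR, Matrix.transpose_mul, Matrix.transpose_transpose, Matrix.mul_assoc,
      ← Matrix.mul_assoc Q, hQ, Matrix.one_mul, hUU]
  have hRQ : Rᵀ * R = Qᵀ * Q := by
    rw [hR, Matrix.transpose_mul, Matrix.transpose_transpose, Matrix.mul_assoc,
      ← Matrix.mul_assoc U, hUU', Matrix.one_mul]
  have heig : ∀ a, hS.eigenvalues a = ∑ i, R a i ^ 2 * d i := by
    intro a
    have h1 : R * Matrix.diagonal d * Rᵀ = Matrix.diagonal hS.eigenvalues := by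
      rw [← hspec, hR, hSdef, Matrix.transpose_mul, Matrix.transpose_transpose]
      simp only [Matrix.mul_assoc]
    have := congrFun (congrFun h1 a) a
    rw [Matrix.diagonal_apply_eq, Matrix.mul_apply] at this
    rw [← this]
    refine Finset.sum_congr rfl fun i _ => ?_
    rw [Matrix.mul_diagonal, Matrix.transpose_apply]; ring
  have hdetS : S.det = ∏ a, hS.eigenvalues a := by
    have := hS.det_eq_prod_eigenvalues
    simpa using this
  have hcol : ∀ i, ∑ a, Q a i ^ 2 = ∑ a, R a i ^ 2 := by
    intro i
    have := congrFun (congrFun hRQ i) i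
    simp only [Matrix.mul_apply, Matrix.transpose_apply] at this
    simp only [sq]; exact this.symm
  have hpos : ∀ a, 0 < hS.eigenvalues a := by
    intro a
    rw [heig]
    have h1 := sum_sq_row_eq_one hRR a
    obtain ⟨i, -, hi⟩ : ∃ i ∈ Finset.univ, R a i ^ 2 ≠ 0 :=
      Finset.exists_ne_zero_of_sum_ne_zero (by rw [h1]; exact one_ne_zero)
    exact Finset.sum_pos' (fun j _ => mul_nonneg (sq_nonneg _) (hd j).le)
      ⟨i, Finset.mem_univ _, mul_pos (lt_of_le_of_ne (sq_nonneg _) hi.symm) (hd i)⟩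
  refine ⟨hdetS ▸ Finset.prod_pos fun a _ => hpos a, ?_⟩
  rw [hdetS, Real.log_prod fun a _ => (hpos a).ne']
  simp only [hcol, Finset.sum_mul]
  rw [Finset.sum_comm]
  refine Finset.sum_le_sum fun a _ => ?_
  rw [heig]
  have := strictConcaveOn_log_Ioi.concaveOn.le_map_sum (t := Finset.univ)
    (w := fun i => R a i ^ 2) (p := d) (fun i _ => sq_nonneg _) (sum_sq_row_eq_one hRR a)
    (fun i _ => hd i)
  simpa using this

lemma det_projection_mul_diagonal_add {ι κ : Type*} [Fintype ι] [Fintype κ] [DecidableEq ι]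
    [DecidableEq κ] {Q : Matrix ι κ ℝ} (hQ : Q * Qᵀ = 1) (d : κ → ℝ) :
    (Qᵀ * Q * Matrix.diagonal d + (1 - Qᵀ * Q)).det = (Q * Matrix.diagonal d * Qᵀ).det := by
  have h1 : Qᵀ * Q * Matrix.diagonal d + (1 - Qᵀ * Q)
      = 1 + Qᵀ * (Q * (Matrix.diagonal d - 1)) := by
    rw [Matrix.mul_sub, Matrix.mul_sub, Matrix.mul_one, Matrix.mul_assoc]; abel
  have h2 : Q * Matrix.diagonal d * Qᵀ = 1 + Q * (Matrix.diagonal d - 1) * Qᵀ := by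
    rw [Matrix.mul_sub, Matrix.sub_mul, Matrix.mul_one, hQ]; abel
  rw [h1, h2, Matrix.det_one_add_mul_comm]

/-! ### Product densities and the standard Gaussian -/

lemma pi_withDensity_ofReal {ι : Type*} [Fintype ι] {f : ι → ℝ → ℝ}
    (hf : ∀ i, Integrable (f i)) (hf0 : ∀ i x, 0 ≤ f i x) :
    Measure.pi (fun i => volume.withDensity fun x => ENNReal.ofReal (f i x)) =
      (volume : Measure (ι → ℝ)).withDensity fun x => ENNReal.ofReal (∏ i, f i (x i)) := by
  have : ∀ i, IsFiniteMeasure ((volume : Measure ℝ).withDensity fun x => ENNReal.ofReal (f i x)) :=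
    fun i => isFiniteMeasure_withDensity_ofReal (hf i).2
  refine Measure.pi_eq fun s hs => ?_
  have hprod : Integrable (fun x : ι → ℝ => ∏ i, (s i).indicator (f i) (x i)) :=
    Integrable.fintype_prod fun i => (hf i).indicator (hs i)
  have hind : ∀ i x, 0 ≤ (s i).indicator (f i) x := fun i x =>
    indicator_nonneg (fun y _ => hf0 i y) x
  have h1 : ∀ x : ι → ℝ, (univ.pi s).indicator
      (fun x => ENNReal.ofReal (∏ i, f i (x i))) x
      = ENNReal.ofReal (∏ i, (s i).indicator (f i) (x i)) := by
    intro x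
    by_cases hx : x ∈ univ.pi s
    · rw [indicator_of_mem hx]
      congr 1
      exact Finset.prod_congr rfl fun i _ => (indicator_of_mem (hx i (mem_univ i)) _).symm
    · rw [indicator_of_notMem hx]
      simp only [mem_univ_pi, not_forall] at hx
      obtain ⟨i, hi⟩ := hx
      rw [Finset.prod_eq_zero (Finset.mem_univ i) (indicator_of_notMem hi _), ENNReal.ofReal_zero]
  rw [withDensity_apply _ (MeasurableSet.univ_pi hs),
    ← lintegral_indicator (MeasurableSet.univ_pi hs),
    lintegral_congr h1, ← ofReal_integral_eq_lintegral_ofReal hprod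
      (Filter.Eventually.of_forall fun x => Finset.prod_nonneg fun i _ => hind i _),
    integral_fintype_prod_volume_eq_prod,
    ENNReal.ofReal_prod_of_nonneg fun i _ => integral_nonneg (hind i)]
  refine Finset.prod_congr rfl fun i _ => ?_
  rw [withDensity_apply _ (hs i), ← lintegral_indicator (hs i),
    ofReal_integral_eq_lintegral_ofReal ((hf i).indicator (hs i))
      (Filter.Eventually.of_forall (hind i))]
  refine lintegral_congr fun x => ?_
  by_cases hx : x ∈ s i <;> simp [hx]

lemma pi_absolutelyContinuous_volume {ι : Type*} [Fintype ι] {ν : ι → Measure ℝ}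
    [∀ i, IsFiniteMeasure (ν i)] (h : ∀ i, ν i ≪ volume) :
    Measure.pi ν ≪ (volume : Measure (ι → ℝ)) := by
  have key : ν = fun i => volume.withDensity
      fun x => ENNReal.ofReal ((ν i).rnDeriv volume x).toReal := by
    funext i
    conv_lhs => rw [← Measure.withDensity_rnDeriv_eq (ν i) volume (h i)]
    refine withDensity_congr_ae ?_
    filter_upwards [Measure.rnDeriv_lt_top (ν i) volume] with x hx
    rw [ENNReal.ofReal_toReal hx.ne]
  rw [key, pi_withDensity_ofReal (fun i => Measure.integrable_toReal_rnDeriv)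
    (fun i x => ENNReal.toReal_nonneg)]
  exact withDensity_absolutelyContinuous _ _

lemma absolutelyContinuous_map_mulVec {m n : ℕ} {A : Matrix (Fin m) (Fin n) ℝ}
    (hA : Function.Surjective A.mulVec) {ν : Measure (Fin n → ℝ)} (hν : ν ≪ volume) :
    ν.map A.mulVec ≪ volume := by
  obtain ⟨c, -, hc⟩ := LinearMap.exists_map_addHaar_eq_smul_addHaar A.mulVecLin
    (volume : Measure (Fin n → ℝ)) (volume : Measure (Fin m → ℝ)) hA
  have hm := measurable_mulVec A
  refine (hν.map hm).trans ?_
  rw [show A.mulVec = A.mulVecLin from rfl, hc]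
  exact Measure.smul_absolutelyContinuous

/-- The standard Gaussian measure on `ℝⁿ`, without Euclidean structure on the space. -/
noncomputable abbrev stdGaussianPi (n : ℕ) : Measure (Fin n → ℝ) :=
  Measure.pi fun _ => gaussianReal 0 1

/-- The density of the standard Gaussian measure on `ℝⁿ`. -/
noncomputable def stdGaussianPDF {n : ℕ} (x : Fin n → ℝ) : ℝ :=
  (√(2 * Real.pi))⁻¹ ^ n * Real.exp (-(x ⬝ᵥ x) / 2)

lemma stdGaussianPDF_pos {n : ℕ} (x : Fin n → ℝ) : 0 < stdGaussianPDF x := by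
  unfold stdGaussianPDF; positivity

lemma measurable_stdGaussianPDF {n : ℕ} : Measurable (stdGaussianPDF (n := n)) := by
  unfold stdGaussianPDF dotProduct; fun_prop

lemma stdGaussianPDF_eq_prod {n : ℕ} (x : Fin n → ℝ) :
    stdGaussianPDF x = ∏ i, gaussianPDFReal 0 1 (x i) := by
  simp only [stdGaussianPDF, gaussianPDFReal, Finset.prod_mul_distrib, ← Real.exp_sum, dotProduct]
  simp [← Finset.sum_div, sq]

lemma stdGaussianPi_eq_withDensity (n : ℕ) :
    stdGaussianPi n = volume.withDensity fun x => ENNReal.ofReal (stdGaussianPDF x) := by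
  have h1 : stdGaussianPi n = Measure.pi (fun _ : Fin n => volume.withDensity
      fun x => ENNReal.ofReal (gaussianPDFReal 0 1 x)) := by
    simp only [stdGaussianPi, gaussianReal_of_var_ne_zero 0 one_ne_zero]; rfl
  rw [h1, pi_withDensity_ofReal (fun _ => integrable_gaussianPDFReal 0 1)
    (fun _ => gaussianPDFReal_nonneg 0 1)]
  simp only [stdGaussianPDF_eq_prod]

/-- The standard Gaussian is preserved by matrices with orthonormal rows: the transpose is isometric,
so the characteristic functions agree. -/
lemma map_mulVec_stdGaussianPi {m n : ℕ} {Q : Matrix (Fin m) (Fin n) ℝ} (hQ : Q * Qᵀ = 1) :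
    (stdGaussianPi n).map Q.mulVec = stdGaussianPi m := by
  have hm := measurable_mulVec Q
  have hto : ∀ k : ℕ, Measurable (WithLp.toLp 2 : (Fin k → ℝ) → EuclideanSpace ℝ (Fin k)) :=
    fun k => (PiLp.continuous_toLp 2 _).measurable
  have hof : ∀ k : ℕ, Measurable (WithLp.ofLp : EuclideanSpace ℝ (Fin k) → (Fin k → ℝ)) :=
    fun k => (PiLp.continuous_ofLp 2 _).measurable
  have key : ((stdGaussianPi n).map Q.mulVec).map (WithLp.toLp 2)
      = (stdGaussianPi m).map (WithLp.toLp 2) := by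
    rw [map_pi_eq_stdGaussian]
    refine Measure.ext_of_charFun (E := EuclideanSpace ℝ (Fin m)) ?_
    ext t
    have h1 : charFun (((stdGaussianPi n).map Q.mulVec).map (WithLp.toLp 2)) t
        = charFun ((stdGaussianPi n).map (WithLp.toLp 2)) (WithLp.toLp 2 (Qᵀ *ᵥ t.ofLp)) := by
      rw [charFun_apply, charFun_apply, Measure.map_map (hto m) hm,
        integral_map ((hto m).comp hm).aemeasurable (by fun_prop),
        integral_map (hto n).aemeasurable (by fun_prop)]
      refine integral_congr_ae (Filter.Eventually.of_forall fun x => ?_)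
      simp only [Function.comp, EuclideanSpace.inner_eq_star_dotProduct, star_trivial]
      rw [Matrix.dotProduct_mulVec, Matrix.mulVec_transpose]
    rw [h1, map_pi_eq_stdGaussian, charFun_stdGaussian, charFun_stdGaussian]
    have h2 : ‖(WithLp.toLp 2 (Qᵀ *ᵥ t.ofLp) : EuclideanSpace ℝ (Fin n))‖ ^ 2 = ‖t‖ ^ 2 := by
      rw [← real_inner_self_eq_norm_sq, ← real_inner_self_eq_norm_sq,
        EuclideanSpace.inner_eq_star_dotProduct, EuclideanSpace.inner_eq_star_dotProduct]
      simp only [star_trivial]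
      rw [Matrix.dotProduct_mulVec, Matrix.vecMul_transpose, Matrix.mulVec_mulVec, hQ,
        Matrix.one_mulVec]
    norm_cast
    rw [h2]
  have := congrArg (Measure.map WithLp.ofLp) key
  rw [Measure.map_map (hof m) (hto m), Measure.map_map (hof m) (hto m)] at this
  simpa [Function.comp_def] using this

lemma integrable_dotProduct_self_stdGaussianPi (n : ℕ) :
    Integrable (fun x : Fin n → ℝ => x ⬝ᵥ x) (stdGaussianPi n) := by
  refine integrable_finsetSum _ fun i _ => ?_
  have h : Integrable (fun u : ℝ => u * u) (gaussianReal 0 1) := by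
    have := (memLp_id_gaussianReal (μ := 0) (v := 1) 2).integrable_sq
    simpa [sq] using this
  exact integrable_comp_eval (μ := fun _ : Fin n => gaussianReal 0 1) (i := i) h

lemma integrable_log_stdGaussianPDF (n : ℕ) :
    Integrable (fun x : Fin n → ℝ => Real.log (stdGaussianPDF x)) (stdGaussianPi n) := by
  have h : (fun x : Fin n → ℝ => Real.log (stdGaussianPDF x))
      = fun x => Real.log ((√(2 * Real.pi))⁻¹ ^ n) + (-1 / 2) * (x ⬝ᵥ x) := by
    funext x
    rw [stdGaussianPDF, Real.log_mul (by positivity) (Real.exp_pos _).ne', Real.log_exp]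
    ring
  rw [h]
  exact (integrable_const _).add ((integrable_dotProduct_self_stdGaussianPi n).const_mul _)

/-! ### Increasing transport on the line -/

lemma measurable_of_hasDerivAt {t d : ℝ → ℝ} (h : ∀ u, HasDerivAt t (d u) u) : Measurable t :=
  (continuous_iff_continuousAt.2 fun u => (h u).continuousAt).measurable

lemma measurable_of_hasDerivAt' {t d : ℝ → ℝ} (h : ∀ u, HasDerivAt t (d u) u) : Measurable d := by
  rw [show d = deriv t from funext fun u => (h u).deriv.symm]
  exact measurable_deriv t

/-- The measure `ν` on the line has density `f` with respect to Lebesgue measure, and `f` is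
continuous and positive on the open interval `I` and zero outside of it. -/
structure IsIntervalDensity (ν : Measure ℝ) (I : Set ℝ) (f : ℝ → ℝ) : Prop where
  isOpen : IsOpen I
  ordConnected : I.OrdConnected
  continuousOn : ContinuousOn f I
  pos : ∀ x ∈ I, 0 < f x
  eq_zero : ∀ x ∉ I, f x = 0
  eq_withDensity : ν = volume.withDensity fun x => ENNReal.ofReal (f x)

namespace IsIntervalDensity

variable {ν : Measure ℝ} {I : Set ℝ} {f : ℝ → ℝ}

lemma nonneg (h : IsIntervalDensity ν I f) (x : ℝ) : 0 ≤ f x := by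
  by_cases hx : x ∈ I
  · exact (h.pos x hx).le
  · exact (h.eq_zero x hx).ge

lemma measurable (h : IsIntervalDensity ν I f) : Measurable f := by
  classical
  have : f = I.piecewise f 0 := by
    funext x
    by_cases hx : x ∈ I
    · simp [hx]
    · simp [hx, h.eq_zero x hx]
  rw [this]
  exact h.continuousOn.measurable_piecewise continuousOn_const h.isOpen.measurableSet

lemma integrable [IsFiniteMeasure ν] (h : IsIntervalDensity ν I f) : Integrable f := by
  refine ⟨h.measurable.aestronglyMeasurable, ?_⟩
  rw [hasFiniteIntegral_iff_ofReal (Filter.Eventually.of_forall h.nonneg),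
    ← setLIntegral_univ, ← withDensity_apply _ MeasurableSet.univ, ← h.eq_withDensity]
  exact measure_lt_top _ _

lemma measure_compl (h : IsIntervalDensity ν I f) : ν Iᶜ = 0 := by
  rw [h.eq_withDensity, withDensity_apply _ h.isOpen.measurableSet.compl]
  rw [setLIntegral_congr_fun (g := fun _ => 0) h.isOpen.measurableSet.compl
    (fun x hx => by simp [h.eq_zero x hx])]
  simp

lemma cdf_eq_integral [IsProbabilityMeasure ν] (h : IsIntervalDensity ν I f) (x : ℝ) :
    cdf ν x = ∫ t in Iic x, f t := by
  rw [cdf_eq_real, measureReal_def, h.eq_withDensity, withDensity_apply _ measurableSet_Iic,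
    integral_eq_lintegral_of_nonneg_ae (Filter.Eventually.of_forall h.nonneg)
      h.measurable.aestronglyMeasurable]

lemma cdf_eq_add_intervalIntegral [IsProbabilityMeasure ν] (h : IsIntervalDensity ν I f) (a x : ℝ) :
    cdf ν x = cdf ν a + ∫ t in a..x, f t := by
  rw [h.cdf_eq_integral, h.cdf_eq_integral, ← intervalIntegral.integral_Iic_sub_Iic
    h.integrable.integrableOn h.integrable.integrableOn]
  ring

lemma continuous_cdf [IsProbabilityMeasure ν] (h : IsIntervalDensity ν I f) :
    Continuous (cdf ν) := by
  have : (cdf ν : ℝ → ℝ) = fun x => cdf ν 0 + ∫ t in (0 : ℝ)..x, f t :=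
    funext (h.cdf_eq_add_intervalIntegral 0)
  rw [this]
  exact continuous_const.add
    (intervalIntegral.continuous_primitive (fun _ _ => h.integrable.intervalIntegrable) 0)

lemma hasDerivAt_cdf [IsProbabilityMeasure ν] (h : IsIntervalDensity ν I f) {x : ℝ} (hx : x ∈ I) :
    HasDerivAt (cdf ν) (f x) x := by
  have : (cdf ν : ℝ → ℝ) = fun x => cdf ν 0 + ∫ t in (0 : ℝ)..x, f t :=
    funext (h.cdf_eq_add_intervalIntegral 0)
  rw [this]
  exact (intervalIntegral.integral_hasDerivAt_right h.integrable.intervalIntegrable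
    h.measurable.stronglyMeasurable.stronglyMeasurableAtFilter
    (h.continuousOn.continuousAt (h.isOpen.mem_nhds hx))).const_add _

lemma strictMonoOn_cdf [IsProbabilityMeasure ν] (h : IsIntervalDensity ν I f) :
    StrictMonoOn (cdf ν) I := by
  refine strictMonoOn_of_deriv_pos h.ordConnected.convex h.continuous_cdf.continuousOn ?_
  intro x hx
  rw [h.isOpen.interior_eq] at hx
  rw [(h.hasDerivAt_cdf hx).deriv]
  exact h.pos x hx

lemma cdf_mem_Ioo [IsProbabilityMeasure ν] (h : IsIntervalDensity ν I f) {x : ℝ} (hx : x ∈ I) :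
    cdf ν x ∈ Ioo (0 : ℝ) 1 := by
  obtain ⟨a, b, hab, hsub⟩ := (mem_nhds_iff_exists_Ioo_subset).1 (h.isOpen.mem_nhds hx)
  obtain ⟨y, hay, hyx⟩ := exists_between hab.1
  obtain ⟨z, hxz, hzb⟩ := exists_between hab.2
  have h1 := h.strictMonoOn_cdf (hsub ⟨hay, hyx.trans hab.2⟩) hx hyx
  have h2 := h.strictMonoOn_cdf hx (hsub ⟨hab.1.trans hxz, hzb⟩) hxz
  exact ⟨(cdf_nonneg ν y).trans_lt h1, h2.trans_le (cdf_le_one ν z)⟩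

lemma exists_cdf_eq [IsProbabilityMeasure ν] (h : IsIntervalDensity ν I f) {u : ℝ}
    (hu : u ∈ Ioo (0 : ℝ) 1) : ∃ x ∈ I, cdf ν x = u := by
  obtain ⟨x, hx⟩ : ∃ x, cdf ν x = u := by
    obtain ⟨a, ha⟩ := ((tendsto_cdf_atBot ν).eventually (gt_mem_nhds hu.1)).exists
    obtain ⟨b, hb⟩ := ((tendsto_cdf_atTop ν).eventually (lt_mem_nhds hu.2)).exists
    exact mem_range_of_exists_le_of_exists_ge h.continuous_cdf ⟨a, ha.le⟩ ⟨b, hb.le⟩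
  refine ⟨x, ?_, hx⟩
  -- Otherwise `I` lies on one side of `x`, and `cdf ν x` is `0` or `1`.
  by_contra hxI
  by_cases hl : ∃ y ∈ I, y ≤ x
  · obtain ⟨y, hy, hyx⟩ := hl
    have hsub : Ioi x ⊆ Iᶜ := fun z hz hzI => hxI (h.ordConnected.out hy hzI ⟨hyx, le_of_lt hz⟩)
    have h0 : ν (Iic x) = 1 := by
      rw [← compl_Ioi, prob_compl_eq_one_iff measurableSet_Ioi]
      exact measure_mono_null hsub h.measure_compl
    rw [cdf_eq_real, measureReal_def, h0] at hx
    exact hu.2.ne (by simpa using hx.symm)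
  · push Not at hl
    have h0 : ν (Iic x) = 0 :=
      measure_mono_null
      (fun z (hz : z ≤ x) hzI => absurd (hl z hzI) (not_lt.2 hz) : Iic x ⊆ Iᶜ) h.measure_compl
    rw [cdf_eq_real, measureReal_def, h0] at hx
    exact hu.1.ne (by simpa using hx)

/-- The quantile function, that is, the inverse of the distribution function, is differentiable on
`(0, 1)`. -/
lemma hasDerivAt_invFunOn_cdf [IsProbabilityMeasure ν] (h : IsIntervalDensity ν I f) {u : ℝ}
    (hu : u ∈ Ioo (0 : ℝ) 1) :
    HasDerivAt (Function.invFunOn (cdf ν) I) (f (Function.invFunOn (cdf ν) I u))⁻¹ u := by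
  set S := Function.invFunOn (cdf ν) I
  have hmem : ∀ {w}, w ∈ Ioo (0 : ℝ) 1 → S w ∈ I := fun hw =>
    Function.invFunOn_mem (h.exists_cdf_eq hw)
  have heq : ∀ {w}, w ∈ Ioo (0 : ℝ) 1 → cdf ν (S w) = w := fun hw =>
    Function.invFunOn_eq (h.exists_cdf_eq hw)
  have hmono : MonotoneOn S (Ioo 0 1) := by
    intro a ha b hb hab
    rw [← h.strictMonoOn_cdf.le_iff_le (hmem ha) (hmem hb), heq ha, heq hb]
    exact hab
  have himage : I ⊆ S '' Ioo 0 1 := fun y hy =>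
    ⟨cdf ν y, h.cdf_mem_Ioo hy, h.strictMonoOn_cdf.injOn.leftInvOn_invFunOn hy⟩
  have hcont : ContinuousAt S u :=
    continuousAt_of_monotoneOn_of_image_mem_nhds hmono (Ioo_mem_nhds hu.1 hu.2)
      (Filter.mem_of_superset (h.isOpen.mem_nhds (hmem hu)) himage)
  refine HasDerivAt.of_local_left_inverse hcont (h.hasDerivAt_cdf (hmem hu))
    (h.pos _ (hmem hu)).ne' ?_
  filter_upwards [Ioo_mem_nhds hu.1 hu.2] with w hw using heq hw

/-- The increasing rearrangement `T = F⁻¹ ∘ G` of a measure with positive continuous density `g` on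
the line to a measure with density `f`: its derivative is `g / (f ∘ T)`. -/
lemma exists_transport [IsProbabilityMeasure ν] (h : IsIntervalDensity ν I f)
    {κ : Measure ℝ} [IsProbabilityMeasure κ] {g : ℝ → ℝ} (hg : IsIntervalDensity κ univ g) :
    ∃ T : ℝ → ℝ, (∀ x, T x ∈ I) ∧ (∀ x, HasDerivAt T (g x / f (T x)) x) ∧ κ.map T = ν := by
  set S := Function.invFunOn (cdf ν) I
  set T : ℝ → ℝ := fun x => S (cdf κ x)
  have hG : ∀ x, cdf κ x ∈ Ioo (0 : ℝ) 1 := fun x => hg.cdf_mem_Ioo (mem_univ x)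
  have hmem : ∀ x, T x ∈ I := fun x => Function.invFunOn_mem (h.exists_cdf_eq (hG x))
  have heq : ∀ x, cdf ν (T x) = cdf κ x := fun x => Function.invFunOn_eq (h.exists_cdf_eq (hG x))
  have hderiv : ∀ x, HasDerivAt T (g x / f (T x)) x := by
    intro x
    have := (h.hasDerivAt_invFunOn_cdf (hG x)).comp x (hg.hasDerivAt_cdf (mem_univ x))
    rwa [inv_mul_eq_div] at this
  have hinj : Function.Injective T := by
    intro x y hxy
    have : cdf κ x = cdf κ y := by rw [← heq, ← heq, hxy]
    exact hg.strictMonoOn_cdf.injOn (mem_univ x) (mem_univ y) this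
  have hrange : range T = I := by
    refine subset_antisymm (range_subset_iff.2 hmem) fun y hy => ?_
    obtain ⟨x, -, hx⟩ := hg.exists_cdf_eq (h.cdf_mem_Ioo hy)
    exact ⟨x, h.strictMonoOn_cdf.injOn (hmem x) hy ((heq x).trans hx)⟩
  have hcont : Continuous T := continuous_iff_continuousAt.2 fun x => (hderiv x).continuousAt
  refine ⟨T, hmem, hderiv, ?_⟩
  ext s hs
  have hs' : MeasurableSet (T ⁻¹' s) := hcont.measurable hs
  rw [Measure.map_apply hcont.measurable hs, hg.eq_withDensity, withDensity_apply _ hs',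
    h.eq_withDensity, withDensity_apply _ hs]
  have hcv := lintegral_image_eq_lintegral_abs_deriv_mul hs'
    (fun x _ => (hderiv x).hasDerivWithinAt) hinj.injOn (fun y => ENNReal.ofReal (f y))
  have hint : ∀ x, ENNReal.ofReal |g x / f (T x)| * ENNReal.ofReal (f (T x))
      = ENNReal.ofReal (g x) := by
    intro x
    have hf := h.pos _ (hmem x)
    rw [abs_of_nonneg (div_nonneg (hg.nonneg x) hf.le), ← ENNReal.ofReal_mul
      (div_nonneg (hg.nonneg x) hf.le), div_mul_cancel₀ _ hf.ne']
  simp only [hint] at hcv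
  rw [← hcv, image_preimage_eq_inter_range, hrange, ← lintegral_indicator hs,
    ← lintegral_indicator (hs.inter h.isOpen.measurableSet)]
  refine lintegral_congr fun y => ?_
  by_cases hy : y ∈ I
  · by_cases hys : y ∈ s <;> simp [hy, hys]
  · by_cases hys : y ∈ s <;> simp [hy, hys, h.eq_zero y hy]

lemma integrable_log_and_entropyOfLaw_eq [IsProbabilityMeasure ν] (h : IsIntervalDensity ν I f)
    (hbot : entropyOfLaw ν ≠ ⊥) (htop : entropyOfLaw ν ≠ ⊤) :
    Integrable (fun x => Real.log (f x)) ν ∧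
      entropyOfLaw ν = ((-∫ x, Real.log (f x) ∂ν : ℝ) : EReal) := by
  have hi := integrable_infoDensity_of_entropyOfLaw_finite hbot htop
  have hae := infoDensity_ae_eq_of_withDensity h.measurable h.nonneg h.eq_withDensity
  constructor
  · simpa using (hi.congr hae).neg
  · rw [entropyOfLaw_eq_integral (absolutelyContinuous_of_entropyOfLaw_ne_bot hbot) hi,
      integral_congr_ae hae, integral_neg]

end IsIntervalDensity

lemma isIntervalDensity_gaussianReal (μ : ℝ) {v : ℝ≥0} (hv : v ≠ 0) :
    IsIntervalDensity (gaussianReal μ v) univ (gaussianPDFReal μ v) where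
  isOpen := isOpen_univ
  ordConnected := ordConnected_univ
  continuousOn := by
    unfold gaussianPDFReal
    fun_prop
  pos x _ := gaussianPDFReal_pos μ v x hv
  eq_zero x hx := absurd (mem_univ x) hx
  eq_withDensity := gaussianReal_of_var_ne_zero μ hv

lemma gaussianReal_eq_map_std (μ : ℝ) (v : ℝ≥0) :
    gaussianReal μ v = (gaussianReal 0 1).map fun u => √v * u + μ := by
  have h1 : (gaussianReal 0 1).map (fun u => √v * u) = gaussianReal 0 v := by
    rw [gaussianReal_map_const_mul]
    congr 1
    · simp
    · ext; simp
  have h2 : (gaussianReal 0 v).map (fun u => u + μ) = gaussianReal μ v := by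
    rw [gaussianReal_map_add_const, zero_add]
  rw [← h2, ← h1, Measure.map_map (by fun_prop) (by fun_prop)]
  rfl

/-- The increasing transport of a Gaussian of variance `v` to a measure `ν` of the same finite
entropy, read in standardised coordinates on both sides: `ν` is the law of `√v * t G` with `G`
standard Gaussian. Equality of the entropies says exactly that `log t'` has mean zero. -/
lemma exists_standardised_transport {ν : Measure ℝ} [IsProbabilityMeasure ν] {I : Set ℝ} {f : ℝ → ℝ}
    (h : IsIntervalDensity ν I f) {μ : ℝ} {v : ℝ≥0} (hv : v ≠ 0)
    (hbot : entropyOfLaw ν ≠ ⊥) (htop : entropyOfLaw ν ≠ ⊤)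
    (heq : entropyOfLaw (gaussianReal μ v) = entropyOfLaw ν) :
    ∃ t d : ℝ → ℝ, (∀ u, HasDerivAt t (d u) u) ∧ (∀ u, 0 < d u) ∧
      Integrable (fun u => Real.log (d u)) (gaussianReal 0 1) ∧
      ∫ u, Real.log (d u) ∂gaussianReal 0 1 = 0 ∧
      (gaussianReal 0 1).map (fun u => √v * t u) = ν := by
  have hg := isIntervalDensity_gaussianReal μ hv
  obtain ⟨T, hmem, hT, hmap⟩ := h.exists_transport hg
  have hTm : Measurable T := measurable_of_hasDerivAt hT
  have hσ : √(v : ℝ) ≠ 0 := (Real.sqrt_pos.2 (by positivity)).ne'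
  have hfpos := fun x => h.pos _ (hmem x)
  have hgpos := fun x => gaussianPDFReal_pos μ v x hv
  obtain ⟨hfi, hfe⟩ := h.integrable_log_and_entropyOfLaw_eq hbot htop
  obtain ⟨hgi, hge⟩ := hg.integrable_log_and_entropyOfLaw_eq (heq ▸ hbot) (heq ▸ htop)
  have hlogf : Measurable fun x => Real.log (f x) := Real.measurable_log.comp h.measurable
  have hfi' : Integrable (fun x => Real.log (f (T x))) (gaussianReal μ v) := by
    rw [← hmap] at hfi
    exact hfi.comp_measurable hTm
  have hfint : ∫ x, Real.log (f (T x)) ∂gaussianReal μ v = ∫ x, Real.log (f x) ∂ν := by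
    rw [← hmap, integral_map hTm.aemeasurable hlogf.aestronglyMeasurable]
  set D : ℝ → ℝ := fun x => gaussianPDFReal μ v x / f (T x)
  have hlogD : (fun x => Real.log (D x))
      = fun x => Real.log (gaussianPDFReal μ v x) - Real.log (f (T x)) := by
    funext x
    exact Real.log_div (hgpos x).ne' (hfpos x).ne'
  have hDi : Integrable (fun x => Real.log (D x)) (gaussianReal μ v) := by
    rw [hlogD]; exact hgi.sub hfi'
  have hD0 : ∫ x, Real.log (D x) ∂gaussianReal μ v = 0 := by
    rw [hlogD, integral_sub hgi hfi', hfint]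
    rw [hge, hfe, EReal.coe_eq_coe_iff] at heq
    linarith
  have hS : Measurable fun u => √(v : ℝ) * u + μ := by fun_prop
  have hDi0 := hDi
  rw [gaussianReal_eq_map_std] at hDi hD0
  rw [integral_map hS.aemeasurable hDi.aestronglyMeasurable] at hD0
  refine ⟨fun u => T (√v * u + μ) / √v, fun u => D (√v * u + μ), fun u => ?_, fun u =>
    div_pos (hgpos _) (hfpos _), hDi.comp_measurable hS, hD0, ?_⟩
  · have h1 : HasDerivAt (fun u => √(v : ℝ) * u + μ) (√(v : ℝ)) u := by
      simpa using ((hasDerivAt_id u).const_mul √(v : ℝ)).add_const μ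
    have h2 := ((hT (√v * u + μ)).comp u h1).div_const √(v : ℝ)
    rwa [mul_div_cancel_right₀ _ hσ] at h2
  · have : (fun u => √(v : ℝ) * (T (√v * u + μ) / √v)) = T ∘ fun u => √(v : ℝ) * u + μ := by
      funext u
      simp only [Function.comp]
      field_simp
    rw [this, ← Measure.map_map hTm hS, ← gaussianReal_eq_map_std, hmap]

/-! ### Entropy of a linear image of a transported Gaussian -/

lemma lintegral_comp_mulVec {m : ℕ} {B : Matrix (Fin m) (Fin m) ℝ} (hB : B.det ≠ 0)
    (g : (Fin m → ℝ) → ℝ≥0∞) :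
    ENNReal.ofReal |B.det| * ∫⁻ u, g (B *ᵥ u) = ∫⁻ w, g w := by
  have hinj : Function.Injective B.mulVec :=
    Matrix.mulVec_injective_iff_isUnit.2 ((Matrix.isUnit_iff_isUnit_det B).2 hB.isUnit)
  have hsurj : Function.Surjective B.mulVec :=
    Matrix.mulVec_surjective_iff_isUnit.2 ((Matrix.isUnit_iff_isUnit_det B).2 hB.isUnit)
  have h := lintegral_image_eq_lintegral_abs_det_fderiv_mul (volume : Measure (Fin m → ℝ))
    (s := univ) MeasurableSet.univ (f := B.mulVec)
    (f' := fun _ => LinearMap.toContinuousLinearMap B.mulVecLin)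
    (fun x _ => (LinearMap.toContinuousLinearMap B.mulVecLin).hasFDerivWithinAt) hinj.injOn g
  have hdet : (LinearMap.toContinuousLinearMap B.mulVecLin).det = B.det := by
    rw [LinearMap.det_toContinuousLinearMap, ← Matrix.toLin'_apply', LinearMap.det_toLin']
  rw [image_univ, hsurj.range_eq] at h
  simp only [Measure.restrict_univ, hdet] at h
  rw [h, lintegral_const_mul' _ _ ENNReal.ofReal_ne_top]

lemma dotProduct_self_sub_mulVec {m n : ℕ} {Q : Matrix (Fin m) (Fin n) ℝ} (hQ : Q * Qᵀ = 1)
    (x : Fin n → ℝ) :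
    (x - Qᵀ *ᵥ (Q *ᵥ x)) ⬝ᵥ (x - Qᵀ *ᵥ (Q *ᵥ x)) = x ⬝ᵥ x - (Q *ᵥ x) ⬝ᵥ (Q *ᵥ x) := by
  have h1 : x ⬝ᵥ Qᵀ *ᵥ (Q *ᵥ x) = (Q *ᵥ x) ⬝ᵥ (Q *ᵥ x) := by
    rw [Matrix.dotProduct_mulVec, Matrix.vecMul_transpose]
  have h2 : (Qᵀ *ᵥ (Q *ᵥ x)) ⬝ᵥ (Qᵀ *ᵥ (Q *ᵥ x)) = (Q *ᵥ x) ⬝ᵥ (Q *ᵥ x) := by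
    rw [Matrix.dotProduct_mulVec, Matrix.vecMul_transpose, Matrix.mulVec_mulVec, hQ,
      Matrix.one_mulVec]
  rw [sub_dotProduct, dotProduct_sub, dotProduct_sub, h1, h2,
    dotProduct_comm (Qᵀ *ᵥ (Q *ᵥ x)) x, h1]
  ring

/-- The conditional density of a standard Gaussian `x` given `Qx`, for `Q` with orthonormal rows:
it depends only on the component of `x` orthogonal to the rows. -/
noncomputable def gaussianFibrePDF {m n : ℕ} (Q : Matrix (Fin m) (Fin n) ℝ) (x : Fin n → ℝ) : ℝ :=
  stdGaussianPDF x / stdGaussianPDF (Q *ᵥ x)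

lemma gaussianFibrePDF_congr {m n : ℕ} {Q : Matrix (Fin m) (Fin n) ℝ} (hQ : Q * Qᵀ = 1)
    {x y : Fin n → ℝ} (h : x - Qᵀ *ᵥ (Q *ᵥ x) = y - Qᵀ *ᵥ (Q *ᵥ y)) :
    gaussianFibrePDF Q x = gaussianFibrePDF Q y := by
  have key : ∀ z, gaussianFibrePDF Q z = (√(2 * Real.pi))⁻¹ ^ n / (√(2 * Real.pi))⁻¹ ^ m *
      Real.exp (-((z - Qᵀ *ᵥ (Q *ᵥ z)) ⬝ᵥ (z - Qᵀ *ᵥ (Q *ᵥ z))) / 2) := by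
    intro z
    rw [dotProduct_self_sub_mulVec hQ, gaussianFibrePDF, stdGaussianPDF, stdGaussianPDF,
      mul_div_mul_comm, ← Real.exp_sub]
    congr 2
    ring
  rw [key, key, h]

/-- Integrating over the fibres of `Q` against the conditional Gaussian density. -/
lemma lintegral_comp_mulVec_mul_gaussianFibrePDF {m n : ℕ} {Q : Matrix (Fin m) (Fin n) ℝ}
    (hQ : Q * Qᵀ = 1) {g : (Fin m → ℝ) → ℝ≥0∞} (hg : Measurable g) :
    ∫⁻ x, g (Q *ᵥ x) * ENNReal.ofReal (gaussianFibrePDF Q x) = ∫⁻ u, g u := by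
  have hQm := measurable_mulVec Q
  have hp : ∀ k, Measurable fun x : Fin k → ℝ => ENNReal.ofReal (stdGaussianPDF x) :=
    fun k => measurable_stdGaussianPDF.ennreal_ofReal
  have hpos : ∀ {k} (x : Fin k → ℝ), 0 < ENNReal.ofReal (stdGaussianPDF x) :=
    fun x => ENNReal.ofReal_pos.2 (stdGaussianPDF_pos x)
  have hq : Measurable fun u => g u / ENNReal.ofReal (stdGaussianPDF u) := hg.div (hp m)
  have h1 : ∫⁻ u, g u / ENNReal.ofReal (stdGaussianPDF u) ∂stdGaussianPi m = ∫⁻ u, g u := by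
    rw [stdGaussianPi_eq_withDensity, lintegral_withDensity_eq_lintegral_mul _ (hp m) hq]
    refine lintegral_congr fun u => ?_
    exact ENNReal.mul_div_cancel (hpos u).ne' ENNReal.ofReal_ne_top
  have hq' : Measurable fun x => g (Q *ᵥ x) / ENNReal.ofReal (stdGaussianPDF (Q *ᵥ x)) :=
    hq.comp hQm
  rw [← h1, ← map_mulVec_stdGaussianPi hQ, lintegral_map hq hQm,
    stdGaussianPi_eq_withDensity, lintegral_withDensity_eq_lintegral_mul _ (hp n) hq']
  refine lintegral_congr fun x => ?_
  rw [gaussianFibrePDF, ENNReal.ofReal_div_of_pos (stdGaussianPDF_pos _), Pi.mul_apply]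
  simp only [ENNReal.div_eq_inv_mul]
  ring

section Transport

variable {m n : ℕ} {Q : Matrix (Fin m) (Fin n) ℝ} {t d : Fin n → ℝ → ℝ}

/-- The coordinatewise map `x ↦ (t i (x i))` followed along the row space of `Q` only, the component
of `x` orthogonal to it being kept. -/
def rowSpaceTransport (Q : Matrix (Fin m) (Fin n) ℝ) (t : Fin n → ℝ → ℝ) (x : Fin n → ℝ) :
    Fin n → ℝ :=
  Qᵀ *ᵥ (Q *ᵥ fun i => t i (x i)) + (x - Qᵀ *ᵥ (Q *ᵥ x))

lemma mulVec_rowSpaceTransport (hQ : Q * Qᵀ = 1) (x : Fin n → ℝ) :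
    Q *ᵥ rowSpaceTransport Q t x = Q *ᵥ fun i => t i (x i) := by
  rw [rowSpaceTransport, Matrix.mulVec_add, Matrix.mulVec_sub, Matrix.mulVec_mulVec,
    Matrix.mulVec_mulVec _ Q Qᵀ, hQ, Matrix.one_mulVec, Matrix.one_mulVec, sub_self, add_zero]

lemma rowSpaceTransport_sub (hQ : Q * Qᵀ = 1) (x : Fin n → ℝ) :
    rowSpaceTransport Q t x - Qᵀ *ᵥ (Q *ᵥ rowSpaceTransport Q t x) = x - Qᵀ *ᵥ (Q *ᵥ x) := by
  rw [mulVec_rowSpaceTransport hQ, rowSpaceTransport, add_sub_cancel_left]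

/-- Injectivity is monotonicity: two points with the same image differ by a vector `Qᵀ u`, and
`∑ (t i (x i) - t i (y i)) * (x i - y i)` vanishes. -/
lemma rowSpaceTransport_injective (hQ : Q * Qᵀ = 1) (ht : ∀ i, StrictMono (t i)) :
    Function.Injective (rowSpaceTransport Q t) := by
  intro x y hxy
  have h1 : Q *ᵥ (fun i => t i (x i)) = Q *ᵥ fun i => t i (y i) := by
    rw [← mulVec_rowSpaceTransport hQ, hxy, mulVec_rowSpaceTransport hQ]
  have h2 : x - Qᵀ *ᵥ (Q *ᵥ x) = y - Qᵀ *ᵥ (Q *ᵥ y) := by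
    rw [← rowSpaceTransport_sub (t := t) hQ, hxy, rowSpaceTransport_sub hQ]
  have h3 : x - y = Qᵀ *ᵥ (Q *ᵥ (x - y)) := by
    rw [Matrix.mulVec_sub, Matrix.mulVec_sub]
    rw [sub_eq_sub_iff_add_eq_add] at h2 ⊢
    rw [h2]; abel
  have h4 : ((fun i => t i (x i)) - fun i => t i (y i)) ⬝ᵥ (x - y) = 0 := by
    rw [h3, Matrix.dotProduct_mulVec, Matrix.vecMul_transpose, Matrix.mulVec_sub, h1, sub_self,
      zero_dotProduct]
  have h5 : ∀ i, 0 ≤ (t i (x i) - t i (y i)) * (x i - y i) := by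
    intro i
    rcases le_total (x i) (y i) with h | h
    · exact mul_nonneg_of_nonpos_of_nonpos (sub_nonpos.2 ((ht i).monotone h)) (sub_nonpos.2 h)
    · exact mul_nonneg (sub_nonneg.2 ((ht i).monotone h)) (sub_nonneg.2 h)
  have h6 := (Finset.sum_eq_zero_iff_of_nonneg fun i _ => h5 i).1 h4
  funext i
  rcases mul_eq_zero.1 (h6 i (Finset.mem_univ i)) with h | h
  · exact (ht i).injective (sub_eq_zero.1 h)
  · exact sub_eq_zero.1 h

lemma hasFDerivAt_rowSpaceTransport (hd : ∀ i u, HasDerivAt (t i) (d i u) u) (x : Fin n → ℝ) :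
    HasFDerivAt (rowSpaceTransport Q t) (LinearMap.toContinuousLinearMap (Matrix.mulVecLin
      (Qᵀ * Q * Matrix.diagonal (fun i => d i (x i)) + (1 - Qᵀ * Q)))) x := by
  have hT : HasFDerivAt (fun (x : Fin n → ℝ) i => t i (x i)) (LinearMap.toContinuousLinearMap
      (Matrix.mulVecLin (Matrix.diagonal fun i => d i (x i)))) x := by
    rw [hasFDerivAt_pi']
    intro i
    have h1 := (hd i (x i)).hasFDerivAt.comp x
      ((ContinuousLinearMap.proj (R := ℝ) (φ := fun _ : Fin n => ℝ) i).hasFDerivAt (x := x))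
    refine h1.congr_fderiv ?_
    ext v
    simp [Matrix.mulVec_diagonal, mul_comm]
  have hP : ∀ y : Fin n → ℝ, HasFDerivAt (fun z => Qᵀ *ᵥ (Q *ᵥ z))
      (LinearMap.toContinuousLinearMap (Matrix.mulVecLin (Qᵀ * Q))) y := by
    intro y
    have : (fun z => Qᵀ *ᵥ (Q *ᵥ z)) = LinearMap.toContinuousLinearMap
        (Matrix.mulVecLin (Qᵀ * Q)) := by
      funext z; exact Matrix.mulVec_mulVec z Qᵀ Q
    rw [this]
    exact ContinuousLinearMap.hasFDerivAt _
  have h := ((hP _).comp x hT).add ((hasFDerivAt_id x).sub (hP x))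
  refine h.congr_fderiv ?_
  ext v
  simp [Matrix.mulVec_mulVec]

/-- The likelihood ratio bound behind the lower estimate: the second factor is the reciprocal of the
conditional density of `B Q t(x)` at its own value, given the component of `x` orthogonal to the rows
of `Q`, and the expected ratio of any density to this conditional density is at most one. -/
lemma lintegral_density_div_conditional_le (hQ : Q * Qᵀ = 1) {B : Matrix (Fin m) (Fin m) ℝ}
    (hB : B.det ≠ 0) (hd : ∀ i u, HasDerivAt (t i) (d i u) u) (hd0 : ∀ i u, 0 < d i u)
    {g : (Fin m → ℝ) → ℝ≥0∞} (hg : Measurable g) :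
    ∫⁻ x, g (B *ᵥ (Q *ᵥ fun i => t i (x i))) * ENNReal.ofReal (|B.det| *
      (Q * Matrix.diagonal (fun i => d i (x i)) * Qᵀ).det / stdGaussianPDF (Q *ᵥ x))
        ∂stdGaussianPi n ≤ ∫⁻ w, g w := by
  have hdm : ∀ i, Measurable (d i) := fun i => measurable_of_hasDerivAt' (hd i)
  have htm : ∀ i, Measurable (t i) := fun i => measurable_of_hasDerivAt (hd i)
  have htmono : ∀ i, StrictMono (t i) := fun i =>
    strictMono_of_hasDerivAt_pos (hd i) (hd0 i)
  have hQm := measurable_mulVec Q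
  have hBm := measurable_mulVec B
  set J : (Fin n → ℝ) → ℝ := fun x => (Q * Matrix.diagonal (fun i => d i (x i)) * Qᵀ).det with hJ
  have hJpos : ∀ x, 0 < J x := fun x => (sum_mul_log_le_log_det hQ fun i => hd0 i (x i)).1
  have hJm : Measurable J := by
    have hc : Continuous fun e : Fin n → ℝ => (Q * Matrix.diagonal e * Qᵀ).det := by fun_prop
    exact hc.measurable.comp (measurable_pi_lambda _ fun i => (hdm i).comp (measurable_pi_apply i))
  have hcv := lintegral_image_eq_lintegral_abs_det_fderiv_mul (volume : Measure (Fin n → ℝ))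
    (s := univ) MeasurableSet.univ
    (fun x _ => (hasFDerivAt_rowSpaceTransport (Q := Q) hd x).hasFDerivWithinAt)
    (rowSpaceTransport_injective hQ htmono).injOn
    (fun y => ENNReal.ofReal |B.det| * g (B *ᵥ (Q *ᵥ y)) * ENNReal.ofReal (gaussianFibrePDF Q y))
  have hdet : ∀ x, (LinearMap.toContinuousLinearMap (Matrix.mulVecLin
      (Qᵀ * Q * Matrix.diagonal (fun i => d i (x i)) + (1 - Qᵀ * Q)))).det = J x := by
    intro x
    rw [LinearMap.det_toContinuousLinearMap, ← Matrix.toLin'_apply', LinearMap.det_toLin',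
      det_projection_mul_diagonal_add hQ]
  calc _ = ∫⁻ x in univ, ENNReal.ofReal |(LinearMap.toContinuousLinearMap (Matrix.mulVecLin
      (Qᵀ * Q * Matrix.diagonal (fun i => d i (x i)) + (1 - Qᵀ * Q)))).det| *
        (ENNReal.ofReal |B.det| * g (B *ᵥ (Q *ᵥ rowSpaceTransport Q t x)) *
          ENNReal.ofReal (gaussianFibrePDF Q (rowSpaceTransport Q t x))) := by
        rw [stdGaussianPi_eq_withDensity, lintegral_withDensity_eq_lintegral_mul _
          measurable_stdGaussianPDF.ennreal_ofReal, Measure.restrict_univ]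
        · refine lintegral_congr fun x => ?_
          rw [hdet, abs_of_pos (hJpos x), mulVec_rowSpaceTransport hQ,
            gaussianFibrePDF_congr hQ (rowSpaceTransport_sub hQ x), Pi.mul_apply, gaussianFibrePDF,
            ENNReal.ofReal_div_of_pos (stdGaussianPDF_pos _),
            ENNReal.ofReal_div_of_pos (stdGaussianPDF_pos _), ENNReal.ofReal_mul (abs_nonneg _)]
          simp only [ENNReal.div_eq_inv_mul]
          ring
        · refine ((hg.comp (hBm.comp (hQm.comp ?_))).mul ?_)
          · exact measurable_pi_lambda _ fun i => (htm i).comp (measurable_pi_apply i)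
          · exact ((hJm.const_mul _).div (measurable_stdGaussianPDF.comp hQm)).ennreal_ofReal
    _ = _ := hcv.symm
    _ ≤ ∫⁻ y, ENNReal.ofReal |B.det| * g (B *ᵥ (Q *ᵥ y)) * ENNReal.ofReal (gaussianFibrePDF Q y) :=
        setLIntegral_le_lintegral _ _
    _ = ENNReal.ofReal |B.det| * ∫⁻ u, g (B *ᵥ u) := by
        rw [lintegral_comp_mulVec_mul_gaussianFibrePDF
          (g := fun u => ENNReal.ofReal |B.det| * g (B *ᵥ u)) hQ ((hg.comp hBm).const_mul _),
          lintegral_const_mul' _ _ ENNReal.ofReal_ne_top]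
    _ = _ := lintegral_comp_mulVec hB g

end Transport

/-! ### Comparison with a Gaussian image -/

lemma integrable_of_lintegral_ofReal_le_one {α : Type*} [MeasurableSpace α] {μ : Measure α}
    {ρ : α → ℝ} (hm : AEStronglyMeasurable ρ μ) (h0 : ∀ᵐ a ∂μ, 0 ≤ ρ a)
    (h : ∫⁻ a, ENNReal.ofReal (ρ a) ∂μ ≤ 1) : Integrable ρ μ ∧ ∫ a, ρ a ∂μ ≤ 1 := by
  refine ⟨⟨hm, (hasFiniteIntegral_iff_ofReal h0).2 (h.trans_lt ENNReal.one_lt_top)⟩, ?_⟩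
  rw [integral_eq_lintegral_of_nonneg_ae h0 hm]
  exact ENNReal.toReal_le_of_le_ofReal zero_le_one (by simpa using h)

/-- The entropy of `B Q G + c`, for `G` standard Gaussian, `B` invertible and `Q` with orthonormal
rows, written as the expectation of minus the logarithm of its density. Since `Q G` is again standard
Gaussian, that density at `B Q x + c` is `stdGaussianPDF (Q x) / |det B|`. -/
noncomputable def gaussianImageEntropy {m n : ℕ} (B : Matrix (Fin m) (Fin m) ℝ)
    (Q : Matrix (Fin m) (Fin n) ℝ) : ℝ :=
  ∫ x, (Real.log |B.det| - Real.log (stdGaussianPDF (Q *ᵥ x))) ∂stdGaussianPi n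

section Compare

variable {m n : ℕ} {Q : Matrix (Fin m) (Fin n) ℝ} {B : Matrix (Fin m) (Fin m) ℝ}

lemma integrable_gaussianImageEntropy (B : Matrix (Fin m) (Fin m) ℝ) (hQ : Q * Qᵀ = 1) :
    Integrable (fun x => Real.log |B.det| - Real.log (stdGaussianPDF (Q *ᵥ x)))
      (stdGaussianPi n) := by
  have hQm := measurable_mulVec Q
  have h := integrable_log_stdGaussianPDF m
  rw [← map_mulVec_stdGaussianPi hQ] at h
  exact (integrable_const _).sub (h.comp_measurable hQm)

/-- Gibbs' inequality, with the Gaussian density of `B Q G + c` as reference density. -/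
lemma entropyOfLaw_affine_gaussian_le (hQ : Q * Qᵀ = 1) (hB : B.det ≠ 0) (c : Fin m → ℝ) :
    entropyOfLaw ((stdGaussianPi n).map fun x => B *ᵥ (Q *ᵥ x) + c)
      ≤ ((gaussianImageEntropy B Q : ℝ) : EReal) := by
  have hQm := measurable_mulVec Q
  have hBm := measurable_mulVec B
  set W : (Fin n → ℝ) → (Fin m → ℝ) := fun x => B *ᵥ (Q *ᵥ x) + c
  have hW : Measurable W := (hBm.comp hQm).add_const c
  set ν := (stdGaussianPi n).map W with hν
  have hprob : IsProbabilityMeasure ν := Measure.isProbabilityMeasure_map hW.aemeasurable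
  by_cases hac : ν ≪ volume
  swap
  · rw [entropyOfLaw, if_neg hac]; exact bot_le
  set f : (Fin m → ℝ) → ℝ := fun w => (ν.rnDeriv volume w).toReal
  have hf : Measurable f := (Measure.measurable_rnDeriv _ _).ennreal_toReal
  have hfpos : ∀ᵐ x ∂stdGaussianPi n, 0 < f (W x) := rnDeriv_map_pos hW.aemeasurable hac
  have hdetpos : 0 < |B.det| := abs_pos.2 hB
  set g : (Fin m → ℝ) → ℝ := fun w => |B.det|⁻¹ * stdGaussianPDF (B⁻¹ *ᵥ (w - c))
  have hgpos : ∀ w, 0 < g w := fun w => mul_pos (inv_pos.2 hdetpos) (stdGaussianPDF_pos _)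
  have hg : Measurable g := (measurable_stdGaussianPDF.comp
    ((measurable_mulVec B⁻¹).comp (measurable_id.sub_const c))).const_mul _
  have hBu : IsUnit B.det := hB.isUnit
  have hgW : ∀ x, g (W x) = |B.det|⁻¹ * stdGaussianPDF (Q *ᵥ x) := by
    intro x
    simp only [g, W, add_sub_cancel_right, Matrix.mulVec_mulVec,
      Matrix.nonsing_inv_mul_cancel_left _ _ hBu]
  have hg1 : ∫⁻ w, ENNReal.ofReal (g w) = 1 := by
    have h1 : ∫⁻ u : Fin m → ℝ, ENNReal.ofReal (stdGaussianPDF u) = 1 := by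
      have := measure_univ (μ := stdGaussianPi m)
      rwa [stdGaussianPi_eq_withDensity, withDensity_apply _ MeasurableSet.univ,
        Measure.restrict_univ] at this
    rw [← lintegral_add_right_eq_self _ c, ← lintegral_comp_mulVec hB]
    have h2 : ∀ u, ENNReal.ofReal (g (B *ᵥ u + c))
        = ENNReal.ofReal |B.det|⁻¹ * ENNReal.ofReal (stdGaussianPDF u) := by
      intro u
      rw [← ENNReal.ofReal_mul (inv_pos.2 hdetpos).le]
      simp only [g, add_sub_cancel_right, Matrix.mulVec_mulVec, Matrix.nonsing_inv_mul _ hBu,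
        Matrix.one_mulVec]
    simp only [h2]
    rw [lintegral_const_mul' _ _ ENNReal.ofReal_ne_top, h1, mul_one, ← ENNReal.ofReal_mul
      hdetpos.le, mul_inv_cancel₀ hdetpos.ne', ENNReal.ofReal_one]
  set ρ : (Fin n → ℝ) → ℝ := fun x => g (W x) / f (W x)
  have hρ : Integrable ρ (stdGaussianPi n) ∧ ∫ x, ρ x ∂stdGaussianPi n ≤ 1 := by
    refine integrable_of_lintegral_ofReal_le_one
      ((hg.comp hW).div (hf.comp hW)).aestronglyMeasurable
      (Filter.Eventually.of_forall fun x => div_nonneg (hgpos _).le ENNReal.toReal_nonneg) ?_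
    have hgf : Measurable fun w => g w / f w := hg.div hf
    calc ∫⁻ x, ENNReal.ofReal (ρ x) ∂stdGaussianPi n
        = ∫⁻ w, ENNReal.ofReal (g w / f w) ∂ν := by
          rw [hν, lintegral_map hgf.ennreal_ofReal hW]
      _ = ∫⁻ w, ENNReal.ofReal (f w * (g w / f w)) :=
          (lintegral_ofReal_toReal_rnDeriv_mul hac hgf).symm
      _ ≤ ∫⁻ w, ENNReal.ofReal (g w) := by
          refine lintegral_mono fun w => ENNReal.ofReal_le_ofReal ?_
          by_cases h0 : f w = 0
          · rw [h0, zero_mul]; exact (hgpos w).le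
          · rw [mul_div_cancel₀ _ h0]
      _ = 1 := hg1
  have hR := integrable_gaussianImageEntropy B hQ
  refine (entropyOfLaw_map_le_integral hW.aemeasurable
    hac ((hR.add hρ.1).sub (integrable_const 1)) ?_).trans ?_
  · filter_upwards [hfpos] with x hx
    -- `log r ≤ r - 1` at the likelihood ratio `r = g(W) / f(W)`
    have h1 := Real.log_le_sub_one_of_pos (div_pos (hgpos (W x)) hx)
    rw [Real.log_div (hgpos _).ne' hx.ne', hgW, Real.log_mul (inv_pos.2 hdetpos).ne'
      (stdGaussianPDF_pos _).ne', Real.log_inv, ← hgW] at h1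
    change -Real.log (f (W x)) ≤ _ + g (W x) / f (W x) - 1
    linarith
  · rw [EReal.coe_le_coe_iff]
    have h1 := integral_sub' (hR.add hρ.1) (integrable_const (1 : ℝ))
    rw [integral_add' hR hρ.1] at h1
    refine h1.le.trans ?_
    simp only [integral_const, probReal_univ, one_smul, gaussianImageEntropy]
    linarith [hρ.2]

/-- The entropy of `B Q t(G)` is at least that of `B Q G` as soon as each `log (t i)'` has mean zero
under the standard Gaussian. The conditional density of `B Q t(G)` given the component of `G`
orthogonal to the rows of `Q` serves as the reference density, and the determinant inequality bounds
its logarithm. -/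
lemma gaussianImageEntropy_le_entropyOfLaw (hQ : Q * Qᵀ = 1) (hB : B.det ≠ 0)
    {t d : Fin n → ℝ → ℝ} (hd : ∀ i u, HasDerivAt (t i) (d i u) u) (hd0 : ∀ i u, 0 < d i u)
    (hi : ∀ i, Integrable (fun u => Real.log (d i u)) (gaussianReal 0 1))
    (hz : ∀ i, ∫ u, Real.log (d i u) ∂gaussianReal 0 1 = 0)
    (hac : ((stdGaussianPi n).map fun x => B *ᵥ (Q *ᵥ fun i => t i (x i))) ≪ volume) :
    ((gaussianImageEntropy B Q : ℝ) : EReal)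
      ≤ entropyOfLaw ((stdGaussianPi n).map fun x => B *ᵥ (Q *ᵥ fun i => t i (x i))) := by
  have hQm := measurable_mulVec Q
  have hBm := measurable_mulVec B
  have htm : ∀ i, Measurable (t i) := fun i => measurable_of_hasDerivAt (hd i)
  have hdm : ∀ i, Measurable (d i) := fun i => measurable_of_hasDerivAt' (hd i)
  set W : (Fin n → ℝ) → (Fin m → ℝ) := fun x => B *ᵥ (Q *ᵥ fun i => t i (x i))
  have hW : Measurable W := hBm.comp (hQm.comp
    (measurable_pi_lambda _ fun i => (htm i).comp (measurable_pi_apply i)))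
  set ν := (stdGaussianPi n).map W
  have hprob : IsProbabilityMeasure ν := Measure.isProbabilityMeasure_map hW.aemeasurable
  set f : (Fin m → ℝ) → ℝ := fun w => (ν.rnDeriv volume w).toReal
  have hf : Measurable f := (Measure.measurable_rnDeriv _ _).ennreal_toReal
  have hfpos : ∀ᵐ x ∂stdGaussianPi n, 0 < f (W x) := rnDeriv_map_pos hW.aemeasurable hac
  have hdetpos : 0 < |B.det| := abs_pos.2 hB
  set J : (Fin n → ℝ) → ℝ := fun x => (Q * Matrix.diagonal (fun i => d i (x i)) * Qᵀ).det
  have hJ : ∀ x, 0 < J x ∧ ∑ i, (∑ a, Q a i ^ 2) * Real.log (d i (x i)) ≤ Real.log (J x) :=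
    fun x => sum_mul_log_le_log_det hQ fun i => hd0 i (x i)
  have hJm : Measurable J := by
    have hc : Continuous fun e : Fin n → ℝ => (Q * Matrix.diagonal e * Qᵀ).det := by fun_prop
    exact hc.measurable.comp (measurable_pi_lambda _ fun i => (hdm i).comp (measurable_pi_apply i))
  have hκ : ∀ x, 0 < |B.det| * J x / stdGaussianPDF (Q *ᵥ x) := fun x =>
    div_pos (mul_pos hdetpos (hJ x).1) (stdGaussianPDF_pos _)
  set ρ : (Fin n → ℝ) → ℝ := fun x => f (W x) * (|B.det| * J x / stdGaussianPDF (Q *ᵥ x))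
  have hρ : Integrable ρ (stdGaussianPi n) ∧ ∫ x, ρ x ∂stdGaussianPi n ≤ 1 := by
    refine integrable_of_lintegral_ofReal_le_one ((hf.comp hW).mul
      ((hJm.const_mul _).div (measurable_stdGaussianPDF.comp hQm))).aestronglyMeasurable
      (Filter.Eventually.of_forall fun x => mul_nonneg ENNReal.toReal_nonneg (hκ x).le) ?_
    calc ∫⁻ x, ENNReal.ofReal (ρ x) ∂stdGaussianPi n
        = ∫⁻ x, ENNReal.ofReal (f (W x)) * ENNReal.ofReal (|B.det| * J x /
            stdGaussianPDF (Q *ᵥ x)) ∂stdGaussianPi n :=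
          lintegral_congr fun x => ENNReal.ofReal_mul ENNReal.toReal_nonneg
      _ ≤ ∫⁻ w, ENNReal.ofReal (f w) :=
          lintegral_density_div_conditional_le hQ hB hd hd0 hf.ennreal_ofReal
      _ ≤ ∫⁻ w, ν.rnDeriv volume w := lintegral_mono fun w => ENNReal.ofReal_toReal_le
      _ ≤ ν univ := Measure.lintegral_rnDeriv_le
      _ = 1 := measure_univ
  set L : (Fin n → ℝ) → ℝ := fun x => ∑ i, (∑ a, Q a i ^ 2) * Real.log (d i (x i))
  have hLterm : ∀ i, Integrable (fun x : Fin n → ℝ => (∑ a, Q a i ^ 2) * Real.log (d i (x i)))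
      (stdGaussianPi n) := fun i =>
    (integrable_comp_eval (μ := fun _ : Fin n => gaussianReal 0 1) (i := i) (hi i)).const_mul _
  have hL : Integrable L (stdGaussianPi n) := integrable_finsetSum _ fun i _ => hLterm i
  have hL0 : ∫ x, L x ∂stdGaussianPi n = 0 := by
    rw [integral_finsetSum _ fun i _ => hLterm i]
    refine Finset.sum_eq_zero fun i _ => ?_
    rw [integral_const_mul, integral_comp_eval (μ := fun _ : Fin n => gaussianReal 0 1) (i := i)
      (hi i).aestronglyMeasurable, hz i, mul_zero]
  have hR := integrable_gaussianImageEntropy B hQ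
  refine le_trans ?_ (integral_le_entropyOfLaw_map hW.aemeasurable hac
    (((hR.add hL).add (integrable_const 1)).sub hρ.1) ?_)
  · rw [EReal.coe_le_coe_iff]
    have h1 := integral_sub' ((hR.add hL).add (integrable_const (1 : ℝ))) hρ.1
    rw [integral_add' (hR.add hL) (integrable_const 1), integral_add' hR hL, hL0] at h1
    refine le_trans ?_ h1.ge
    simp only [integral_const, probReal_univ, one_smul, gaussianImageEntropy]
    linarith [hρ.2]
  · filter_upwards [hfpos] with x hx
    -- `log r ≤ r - 1` at the likelihood ratio of `f` to the conditional density
    have h1 := Real.log_le_sub_one_of_pos (mul_pos hx (hκ x))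
    rw [Real.log_mul hx.ne' (hκ x).ne', Real.log_div (mul_pos hdetpos (hJ x).1).ne'
      (stdGaussianPDF_pos _).ne', Real.log_mul hdetpos.ne' (hJ x).1.ne'] at h1
    have h2 := (hJ x).2
    change _ + L x + 1 - f (W x) * (|B.det| * J x / stdGaussianPDF (Q *ᵥ x)) ≤ -Real.log (f (W x))
    simp only [L] at *
    linarith

end Compare

/-! ### Linear images of product laws -/

lemma not_absolutelyContinuous_map_mulVec {m n : ℕ} {A : Matrix (Fin m) (Fin n) ℝ}
    (hA : ¬ Function.Surjective A.mulVec) (ν : Measure (Fin n → ℝ)) [IsProbabilityMeasure ν] :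
    ¬ ν.map A.mulVec ≪ volume := by
  intro hac
  have hm := measurable_mulVec A
  have h0 : (volume : Measure (Fin m → ℝ)) (LinearMap.range A.mulVecLin) = 0 := by
    refine Measure.addHaar_submodule _ _ fun h => hA ?_
    exact LinearMap.range_eq_top.1 h
  have h1 := hac h0
  rw [Measure.map_apply hm (Submodule.closed_of_finiteDimensional _).measurableSet] at h1
  have : A.mulVec ⁻¹' (LinearMap.range A.mulVecLin : Set (Fin m → ℝ)) = univ :=
    eq_univ_of_forall fun x => ⟨x, rfl⟩
  rw [this, measure_univ] at h1
  exact one_ne_zero h1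

lemma map_mulVec_of_iIndepFun {Ω : Type*} [MeasurableSpace Ω] {P : Measure Ω}
    [IsProbabilityMeasure P] {m n : ℕ} (A : Matrix (Fin m) (Fin n) ℝ) {X : Fin n → Ω → ℝ}
    (hm : ∀ i, AEMeasurable (X i) P) (hX : iIndepFun X P) :
    P.map (fun ω => A *ᵥ fun i => X i ω) = (Measure.pi fun i => P.map (X i)).map A.mulVec := by
  have hA := measurable_mulVec A
  rw [← (iIndepFun_iff_map_fun_eq_pi_map hm).1 hX,
    AEMeasurable.map_map_of_aemeasurable hA.aemeasurable (aemeasurable_pi_lambda _ hm)]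
  rfl

lemma pi_eq_map_stdGaussianPi {n : ℕ} {ν : Fin n → Measure ℝ} [∀ i, IsProbabilityMeasure (ν i)]
    {s : Fin n → ℝ → ℝ} (hs : ∀ i, Measurable (s i)) (h : ∀ i, (gaussianReal 0 1).map (s i) = ν i) :
    Measure.pi ν = (stdGaussianPi n).map fun x i => s i (x i) := by
  obtain rfl : ν = fun i => (gaussianReal 0 1).map (s i) := funext fun i => (h i).symm
  exact (Measure.pi_map_pi fun i => (hs i).aemeasurable).symm

theorem mainTheorem1 {Ω Ω' : Type*} [MeasurableSpace Ω] [MeasurableSpace Ω']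
    (P : Measure Ω) [IsProbabilityMeasure P] (P' : Measure Ω') [IsProbabilityMeasure P']
    {m n : ℕ} (A : Matrix (Fin m) (Fin n) ℝ)
    (X : Fin n → Ω → ℝ)
    (hX_meas : ∀ i, AEMeasurable (X i) P)
    (hX_indep : iIndepFun X P)
    (hX_dens : ∀ i, HasDensityOnInterval (X i) P)
    (hX_int : ∀ i, Integrable (X i) P)
    (hX_mean : ∀ i, ∫ ω, X i ω ∂P = 0)
    (hX_fin : ∀ i, diffEntropy (X i) P ≠ ⊥ ∧ diffEntropy (X i) P ≠ ⊤)
    (Xs : Fin n → Ω' → ℝ)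
    (hXs_normal : ∀ i, ∃ (μ : ℝ) (v : ℝ≥0), HasLaw (Xs i) (gaussianReal μ v) P')
    (hXs_indep : iIndepFun Xs P')
    (h_same : ∀ i, diffEntropy (Xs i) P' = diffEntropy (X i) P) :
    diffEntropy (fun ω => A *ᵥ (fun i => X i ω)) P ≥
      diffEntropy (fun ω => A *ᵥ (fun i => Xs i ω)) P' := by
  choose μ v hlaw using hXs_normal
  have hXs_meas : ∀ i, AEMeasurable (Xs i) P' := fun i => (hlaw i).aemeasurable
  have hprob : ∀ i, IsProbabilityMeasure (P.map (X i)) := fun i =>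
    Measure.isProbabilityMeasure_map (hX_meas i)
  have hprob' : ∀ i, IsProbabilityMeasure (P'.map (Xs i)) := fun i =>
    Measure.isProbabilityMeasure_map (hXs_meas i)
  simp only [diffEntropy] at hX_fin h_same ⊢
  rw [map_mulVec_of_iIndepFun A hX_meas hX_indep, map_mulVec_of_iIndepFun A hXs_meas hXs_indep,
    ge_iff_le]
  by_cases hA : Function.Surjective A.mulVec
  swap
  · rw [entropyOfLaw, if_neg (not_absolutelyContinuous_map_mulVec hA _)]
    exact bot_le
  simp only [fun i => (hlaw i).map_eq] at h_same ⊢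
  -- A Gaussian of variance zero is a Dirac mass and has entropy `⊥`.
  have hv : ∀ i, v i ≠ 0 := by
    intro i h0
    have hac := absolutelyContinuous_of_entropyOfLaw_ne_bot ((h_same i).symm ▸ (hX_fin i).1)
    rw [h0, gaussianReal_zero_var] at hac
    have := hac (measure_singleton (μ i))
    simp at this
  choose I f hI hIc hfc hfpos hf0 hfd using hX_dens
  have hdens : ∀ i, IsIntervalDensity (P.map (X i)) (I i) (f i) := fun i =>
    ⟨hI i, hIc i, hfc i, hfpos i, hf0 i, hfd i⟩
  choose t d ht hd0 hi hz hmap using fun i =>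
    exists_standardised_transport (hdens i) (hv i) (hX_fin i).1 (hX_fin i).2 (h_same i)
  have htm : ∀ i, Measurable (t i) := fun i => measurable_of_hasDerivAt (ht i)
  have hAm := measurable_mulVec A
  have hσ : ∀ i, √(v i : ℝ) ≠ 0 := fun i =>
    (Real.sqrt_pos.2 (NNReal.coe_pos.2 (pos_iff_ne_zero.2 (hv i)))).ne'
  set D : Matrix (Fin n) (Fin n) ℝ := Matrix.diagonal fun i => √(v i : ℝ) with hD
  -- The standard deviations are absorbed into the matrix.
  have hAD : Function.Surjective (A * D).mulVec := by
    intro y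
    obtain ⟨x, rfl⟩ := hA y
    refine ⟨fun i => x i / √(v i : ℝ), ?_⟩
    rw [← Matrix.mulVec_mulVec]
    congr 1
    funext i
    rw [hD, Matrix.mulVec_diagonal, mul_div_cancel₀ _ (hσ i)]
  obtain ⟨B, Q, hBQ, hB, hQ⟩ := exists_eq_mul_orthonormal_rows _ hAD
  have hsplit : ∀ y : Fin n → ℝ, A *ᵥ (fun i => √(v i : ℝ) * y i) = B *ᵥ (Q *ᵥ y) := by
    intro y
    rw [Matrix.mulVec_mulVec, ← hBQ, ← Matrix.mulVec_mulVec]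
    congr 1
    funext i
    rw [hD, Matrix.mulVec_diagonal]
  have hlawX : (Measure.pi fun i => P.map (X i)).map A.mulVec
      = (stdGaussianPi n).map fun x => B *ᵥ (Q *ᵥ fun i => t i (x i)) := by
    have hsm : ∀ i, Measurable fun u => √(v i : ℝ) * t i u := fun i => (htm i).const_mul _
    rw [pi_eq_map_stdGaussianPi hsm hmap, Measure.map_map hAm (by fun_prop)]
    congr 1
    funext x
    exact hsplit fun i => t i (x i)
  have hlawXs : (Measure.pi fun i => gaussianReal (μ i) (v i)).map A.mulVec
      = (stdGaussianPi n).map fun x => B *ᵥ (Q *ᵥ x) + A *ᵥ μ := by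
    rw [pi_eq_map_stdGaussianPi (s := fun i u => √(v i : ℝ) * u + μ i) (fun i => by fun_prop)
      (fun i => (gaussianReal_eq_map_std (μ i) (v i)).symm), Measure.map_map hAm (by fun_prop)]
    congr 1
    funext x
    rw [← hsplit x, ← Matrix.mulVec_add]
    rfl
  rw [hlawXs]
  refine (entropyOfLaw_affine_gaussian_le hQ hB _).trans ?_
  have hac : (Measure.pi fun i => P.map (X i)).map A.mulVec ≪ volume :=
    absolutelyContinuous_map_mulVec hA (pi_absolutelyContinuous_volume fun i =>
      absolutelyContinuous_of_entropyOfLaw_ne_bot (hX_fin i).1)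
  rw [hlawX] at hac ⊢
  exact gaussianImageEntropy_le_entropyOfLaw hQ hB ht hd0 hi hz hac
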